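/- All vector spaces are over $\mathbb{C}$. A Leibniz superalgebra of type $(n,m)$ is a $\mathbb{Z}_2$-graded space $L=L_0\oplus L_1$ with $\dim L_0=n$, $\dim L_1=m$ and a bilinear product with $[L_\alpha,L_\beta]\subseteq L_{\alpha+\beta}$ and $$[x,[y,z]]=[[x,y],z]-(-1)^{\alpha\beta}[[x,z],y]\qquad (x\in L,\ y\in L_\alpha,\ z\in L_\beta);$$ it is a Lie superalgebra if moreover $[x,y]=-(-1)^{\alpha\beta}[y,x]$ for $x\in L_\alpha$, $y\in L_\beta$. Put $C^0(L)=L$, $C^{k+1}(L)=[C^k(L),L]$; $L$ is nilpotent if $C^k(L)=0$ for some $k$, and the least such $k$ is its nilindex. Let $N^{n,m}$ be the set of nilpotent Leibniz superalgebras of type $(n,m)$, let $f(n,m)$ be the maximal nilindex occurring in $N^{n,m}$, and let $\mathcal{M}^{n,m}\subseteq N^{n,m}$ be the set of those with nilindex $f(n,m)$. Put $C^0(L_i)=L_i$, $C^{k+1}(L_i)=[C^k(L_i),L_0]$ for $i\in\{0,1\}$, and let $\mathcal{ZF}^{n,m}\subseteq N^{n,m}$ be the set of zero-filiform ones, that is,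 those for which $n$ is the least $k$ with $C^k(L_0)=0$ and $m$ is the least $k$ with $C^k(L_1)=0$. For odd $m$ let $K^{2,m}$ be the superalgebra with even basis $X_0,X_1$, odd basis $Y_1,\dots,Y_m$ and nonzero products $$[X_0,Y_i]=-[Y_i,X_0]=Y_{i+1}\ (1\le i\le m-1),\qquad [Y_i,Y_{m+1-i}]=(-1)^{i+1}X_1\ (1\le i\le m).$$ **Theorem.** If $m\ge 5$, then $\mathcal{M}^{2,m}\not\subset\mathcal{ZF}^{2,m}$. More precisely, if $m$ is odd, then $K^{2,m}$ is a Lie superalgebra that belongs to $\mathcal{M}^{2,m}$ and not to $\mathcal{ZF}^{2,m}$; if $m$ is even, then $K^{2,m-1}\oplus\mathbb{C}$, where $\mathbb{C}$ is the one-dimensional purely odd superalgebra with zero product, belongs (up to isomorphism) to $\mathcal{M}^{2,m}$ and not to $\mathcal{ZF}^{2,m}$. -/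

import Mathlib

noncomputable section

namespace LeibnizSuper

/-- Bilinear products ("laws") on the `ℤ/2`-graded complex vector space `V₀ ⊕ V₁`; the product
of `x` and `y` is `μ x y`. -/
abbrev Law (V₀ V₁ : Type) [AddCommGroup V₀] [Module ℂ V₀] [AddCommGroup V₁] [Module ℂ V₁] : Type :=
  (V₀ × V₁) →ₗ[ℂ] (V₀ × V₁) →ₗ[ℂ] (V₀ × V₁)

section General

variable {V₀ V₁ : Type} [AddCommGroup V₀] [Module ℂ V₀] [AddCommGroup V₁] [Module ℂ V₁]
variable {W₀ W₁ : Type} [AddCommGroup W₀] [Module ℂ W₀] [AddCommGroup W₁] [Module ℂ W₁]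

/-- The homogeneous component of degree `α ∈ ℤ/2`: `V₀` for `α = 0` and `V₁` for `α = 1`. -/
def part (V₀ V₁ : Type) [AddCommGroup V₀] [Module ℂ V₀] [AddCommGroup V₁] [Module ℂ V₁]
    (α : ZMod 2) : Submodule ℂ (V₀ × V₁) :=
  if α = 0 then LinearMap.range (LinearMap.inl ℂ V₀ V₁) else LinearMap.range (LinearMap.inr ℂ V₀ V₁)

/-- The sign `(-1)^{αβ}` for degrees `α, β ∈ ℤ/2`. -/
def sgn (α β : ZMod 2) : ℂ := (-1) ^ (α.val * β.val)

/-- Leibniz superalgebra laws: the product respects the grading and satisfies the graded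
(right) Leibniz identity. -/
structure IsLeibniz (μ : Law V₀ V₁) : Prop where
  grading : ∀ (α β : ZMod 2) (x y : V₀ × V₁), x ∈ part V₀ V₁ α → y ∈ part V₀ V₁ β →
    μ x y ∈ part V₀ V₁ (α + β)
  identity : ∀ (α β : ZMod 2) (x y z : V₀ × V₁), y ∈ part V₀ V₁ α → z ∈ part V₀ V₁ β →
    μ x (μ y z) = μ (μ x y) z - sgn α β • μ (μ x z) y

/-- Lie superalgebras are the Leibniz superalgebras with `[x, y] = -(-1)^{αβ} [y, x]`. -/
structure IsLie (μ : Law V₀ V₁) : Prop extends IsLeibniz μ where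
  skew : ∀ (α β : ZMod 2) (x y : V₀ × V₁), x ∈ part V₀ V₁ α → y ∈ part V₀ V₁ β →
    μ x y = -(sgn α β • μ y x)

/-- Starting from a subspace `A`, multiply repeatedly by a subspace `B` on the right:
`A, [A, B], [[A, B], B], …` (each `[·, ·]` is the linear span of the products). -/
def rightSeq (μ : Law V₀ V₁) (A B : Submodule ℂ (V₀ × V₁)) : ℕ → Submodule ℂ (V₀ × V₁)
  | 0 => A
  | k + 1 => Submodule.map₂ μ (rightSeq μ A B k) B

/-- The descending central sequence `C⁰(L) = L`, `Cᵏ⁺¹(L) = [Cᵏ(L), L]`. -/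
def lowerCentral (μ : Law V₀ V₁) (k : ℕ) : Submodule ℂ (V₀ × V₁) :=
  rightSeq μ ⊤ ⊤ k

/-- The sequence `C⁰(Lᵢ) = Lᵢ`, `Cᵏ⁺¹(Lᵢ) = [Cᵏ(Lᵢ), L₀]` for `i ∈ ℤ/2`. -/
def partCentral (μ : Law V₀ V₁) (i : ZMod 2) (k : ℕ) : Submodule ℂ (V₀ × V₁) :=
  rightSeq μ (part V₀ V₁ i) (part V₀ V₁ 0) k

def IsNilpotent (μ : Law V₀ V₁) : Prop := ∃ k, lowerCentral μ k = ⊥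

/-- The smallest `k` with `Cᵏ(L) = 0`; used only for nilpotent laws. -/
def nilindex (μ : Law V₀ V₁) : ℕ := sInf {k | lowerCentral μ k = ⊥}

/-- `L` has super-nilindex `(p, q)`: `p` and `q` are the first indices at which `Cᵖ(L₀)` and
`C^q(L₁)` vanish, so that `C^{p-1}(L₀) ≠ 0`, `C^{q-1}(L₁) ≠ 0`, `Cᵖ(L₀) = C^q(L₁) = 0`. -/
def HasSNilindex (μ : Law V₀ V₁) (p q : ℕ) : Prop :=
  IsLeast {k | partCentral μ 0 k = ⊥} p ∧ IsLeast {k | partCentral μ 1 k = ⊥} q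

/-- Isomorphism of superalgebras: an even linear isomorphism that preserves the products. -/
def Isomorphic (μ : Law V₀ V₁) (ν : Law W₀ W₁) : Prop :=
  ∃ (f₀ : V₀ ≃ₗ[ℂ] W₀) (f₁ : V₁ ≃ₗ[ℂ] W₁), ∀ x y : V₀ × V₁,
    (f₀.prodCongr f₁) (μ x y) = ν ((f₀.prodCongr f₁) x) ((f₀.prodCongr f₁) y)

/-- The direct sum of two superalgebras, with even part `V₀ ⊕ W₀` and odd part `V₁ ⊕ W₁`,
and with the componentwise product. -/
def directSum (μ : Law V₀ V₁) (ν : Law W₀ W₁) : Law (V₀ × W₀) (V₁ × W₁) :=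
  LinearMap.mk₂ ℂ
    (fun a b =>
      let u := μ (a.1.1, a.2.1) (b.1.1, b.2.1)
      let v := ν (a.1.2, a.2.2) (b.1.2, b.2.2)
      ((u.1, v.1), (u.2, v.2)))
    (fun a a' b => by
      have h₁ := μ.map_add₂ (a.1.1, a.2.1) (a'.1.1, a'.2.1) (b.1.1, b.2.1)
      have h₂ := ν.map_add₂ (a.1.2, a.2.2) (a'.1.2, a'.2.2) (b.1.2, b.2.2)
      simp only [Prod.mk_add_mk] at h₁ h₂
      simp [h₁, h₂])
    (fun c a b => by
      have h₁ := μ.map_smul₂ c (a.1.1, a.2.1) (b.1.1, b.2.1)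
      have h₂ := ν.map_smul₂ c (a.1.2, a.2.2) (b.1.2, b.2.2)
      simp only [Prod.smul_mk] at h₁ h₂
      simp [h₁, h₂])
    (fun a b b' => by
      have h₁ := (μ (a.1.1, a.2.1)).map_add (b.1.1, b.2.1) (b'.1.1, b'.2.1)
      have h₂ := (ν (a.1.2, a.2.2)).map_add (b.1.2, b.2.2) (b'.1.2, b'.2.2)
      simp only [Prod.mk_add_mk] at h₁ h₂
      simp [h₁, h₂])
    (fun c a b => by
      have h₁ := (μ (a.1.1, a.2.1)).map_smul c (b.1.1, b.2.1)
      have h₂ := (ν (a.1.2, a.2.2)).map_smul c (b.1.2, b.2.2)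
      simp only [Prod.smul_mk] at h₁ h₂
      simp [h₁, h₂])

end General

/-- Laws on the standard graded space with even dimension `n` and odd dimension `m`. -/
abbrev StdLaw (n m : ℕ) : Type := Law (Fin n → ℂ) (Fin m → ℂ)

/-- `N^{n,m}`: nilpotent Leibniz superalgebra laws of type `(n, m)`. -/
def N (n m : ℕ) : Set (StdLaw n m) := {μ | IsLeibniz μ ∧ IsNilpotent μ}

/-- `M^{n,m}`: the elements of `N^{n,m}` whose nilindex is the maximal nilindex `f(n, m)`
occurring in `N^{n,m}`. -/
def M (n m : ℕ) : Set (StdLaw n m) :=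
  {μ | μ ∈ N n m ∧ IsGreatest (nilindex '' N n m) (nilindex μ)}

/-- `ZF^{n,m}`: the zero-filiform elements of `N^{n,m}`, of super-nilindex `(n, m)`. -/
def ZF (n m : ℕ) : Set (StdLaw n m) := {μ | μ ∈ N n m ∧ HasSNilindex μ n m}

/-- The shift `Y₁ ↦ Y₂ ↦ ⋯ ↦ Y_m ↦ 0`, where `Y_{i+1}` is the basis vector with index `i`. -/
def shift (m : ℕ) : (Fin m → ℂ) →ₗ[ℂ] (Fin m → ℂ) where
  toFun y k := ∑ i : Fin m, if (i : ℕ) + 1 = k then y i else 0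
  map_add' y y' := by
    ext k
    simp only [Pi.add_apply, ← Finset.sum_add_distrib]
    exact Finset.sum_congr rfl fun i _ => by split_ifs <;> simp
  map_smul' c y := by
    ext k
    simp only [Pi.smul_apply, smul_eq_mul, RingHom.id_apply, Finset.mul_sum]
    exact Finset.sum_congr rfl fun i _ => by split_ifs <;> simp

/-- The law `K^{2,m}` in the basis `X₀, X₁ | Y₁, …, Y_m`:
`[X₀, Y_i] = -[Y_i, X₀] = Y_{i+1}` for `1 ≤ i ≤ m - 1`, and
`[Y_i, Y_{m+1-i}] = (-1)^{i+1} X₁` for `1 ≤ i ≤ m`; all other products vanish.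
It is meant for odd `m`. -/
def K (m : ℕ) : StdLaw 2 m :=
  LinearMap.mk₂ ℂ
    (fun a b => (Pi.single 1 (∑ i : Fin m, (-1) ^ (i : ℕ) * a.2 i * b.2 i.rev),
      a.1 0 • shift m b.2 - b.1 0 • shift m a.2))
    (fun a a' b => by
      ext k
      · simp only [Prod.fst_add, Prod.snd_add, Pi.add_apply, mul_add, add_mul,
          Finset.sum_add_distrib, Pi.single_add]
      · simp [add_smul]; ring)
    (fun c a b => by
      ext k
      · fin_cases k
        · simp
        · simp only [Fin.mk_one, Pi.single_eq_same, Prod.smul_fst, Prod.smul_snd, Pi.smul_apply,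
            smul_eq_mul, Finset.mul_sum]
          exact Finset.sum_congr rfl fun i _ => by ring
      · simp; ring)
    (fun a b b' => by
      ext k
      · simp only [Prod.fst_add, Prod.snd_add, Pi.add_apply, mul_add,
          Finset.sum_add_distrib, Pi.single_add]
      · simp [add_smul]; ring)
    (fun c a b => by
      ext k
      · fin_cases k
        · simp
        · simp only [Fin.mk_one, Pi.single_eq_same, Prod.smul_fst, Prod.smul_snd, Pi.smul_apply,
            smul_eq_mul, Finset.mul_sum]
          exact Finset.sum_congr rfl fun i _ => by ring
      · simp; ring)

/-- `ℂ` as a purely odd one-dimensional superalgebra with zero product. -/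
def oddLine : StdLaw 0 1 := 0

end LeibnizSuper

end

/-!
Let `L` be a nilpotent Leibniz superalgebra of type `(2, m)` with `m ≥ 5` and suppose `Cᵐ(L) ≠ 0`.
The odd part cannot lie in `C¹(L)`, and neither can the even part, since then every second step of
the central sequence would cost an even dimension. A dimension count therefore leaves one even
generator `X₀`, one odd generator `Y₁`, one more even element `X₁ ∈ C¹(L)`, and one-dimensional
quotients `Cᵏ(L) / Cᵏ⁺¹(L)` for `1 ≤ k ≤ m`. Comparing parities along the sequence
pushes `X₁` down into `Cᵐ(L)`. Hence `X₁` is central, and the product of odd elements becomes a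
scalar pairing for which right multiplication `R` by `X₀` is skew. Left multiplication by `X₀`
commutes with `R`, and the Leibniz identity gives `[[X₀, y], z] = -[[X₀, z], y]`. For `y = Y₁`
and `z = Rᵐ⁻²(Y₁)` both sides are nonzero, while skewness of `R` gives
`[[X₀, z], y] = (-1)ᵐ⁻² [[X₀, y], z]`, so `m` is odd.

Thus `Cᵐ⁺¹(L) = 0` always, and `Cᵐ(L) = 0` when `m` is even. The superalgebras `K^{2,m}` and
`K^{2,m-1} ⊕ ℂ` attain these bounds, but their even elements have zero products.
-/

namespace LeibnizSuper

open Module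

section Grading

variable {V₀ V₁ : Type} [AddCommGroup V₀] [Module ℂ V₀] [AddCommGroup V₁] [Module ℂ V₁]

theorem mem_part_zero {x : V₀ × V₁} : x ∈ part V₀ V₁ 0 ↔ x.2 = 0 := by
  simp [part, LinearMap.range_inl]

theorem mem_part_one {x : V₀ × V₁} : x ∈ part V₀ V₁ 1 ↔ x.1 = 0 := by
  simp [part, LinearMap.range_inr]

theorem finrank_part_zero : finrank ℂ (part V₀ V₁ 0) = finrank ℂ V₀ :=
  LinearMap.finrank_range_of_inj LinearMap.inl_injective

theorem finrank_part_one : finrank ℂ (part V₀ V₁ 1) = finrank ℂ V₁ :=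
  LinearMap.finrank_range_of_inj LinearMap.inr_injective

theorem eq_zero_or_eq_one (α : ZMod 2) : α = 0 ∨ α = 1 := by
  revert α
  decide

/-- The projection of `V₀ ⊕ V₁` onto its homogeneous component of degree `α`, viewed as an
endomorphism so that components of the same element can be added and multiplied. -/
noncomputable def component (α : ZMod 2) : (V₀ × V₁) →ₗ[ℂ] (V₀ × V₁) :=
  if α = 0 then LinearMap.inl ℂ V₀ V₁ ∘ₗ LinearMap.fst ℂ V₀ V₁
  else LinearMap.inr ℂ V₀ V₁ ∘ₗ LinearMap.snd ℂ V₀ V₁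

theorem component_zero_apply (x : V₀ × V₁) : component 0 x = (x.1, 0) := by
  simp [component]

theorem component_one_apply (x : V₀ × V₁) : component 1 x = (0, x.2) := by
  simp [component]

theorem component_mem (α : ZMod 2) (x : V₀ × V₁) : component α x ∈ part V₀ V₁ α := by
  obtain rfl | rfl := eq_zero_or_eq_one α
  · exact mem_part_zero.2 (by simp [component_zero_apply])
  · exact mem_part_one.2 (by simp [component_one_apply])

theorem component_add_component (α : ZMod 2) (x : V₀ × V₁) :
    component α x + component (α + 1) x = x := by
  obtain rfl | rfl := eq_zero_or_eq_one α
  · simp [component]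
  · simp [component, CharTwo.add_self_eq_zero]

theorem component_of_mem {α : ZMod 2} {x : V₀ × V₁} (hx : x ∈ part V₀ V₁ α) :
    component α x = x := by
  obtain rfl | rfl := eq_zero_or_eq_one α
  · exact (component_zero_apply x).trans (Prod.ext rfl (mem_part_zero.1 hx).symm)
  · exact (component_one_apply x).trans (Prod.ext (mem_part_one.1 hx).symm rfl)

theorem component_of_mem_succ {α : ZMod 2} {x : V₀ × V₁} (hx : x ∈ part V₀ V₁ (α + 1)) :
    component α x = 0 := by
  simpa only [component_of_mem hx, add_eq_right] using component_add_component α x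

end Grading

section Identities

variable {V₀ V₁ : Type} [AddCommGroup V₀] [Module ℂ V₀] [AddCommGroup V₁] [Module ℂ V₁]
variable {μ : Law V₀ V₁}

namespace IsLeibniz

theorem component_mul (h : IsLeibniz μ) (α : ZMod 2) (x y : V₀ × V₁) :
    component α (μ x y) =
      μ (component α x) (component 0 y) + μ (component (α + 1) x) (component 1 y) := by
  have hdeg (β γ : ZMod 2) : μ (component β x) (component γ y) ∈ part V₀ V₁ (β + γ) :=
    h.grading β γ _ _ (component_mem β x) (component_mem γ y)
  have h₀₀ := hdeg α 0
  have h₁₁ := hdeg (α + 1) 1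
  rw [add_zero] at h₀₀
  rw [CharTwo.add_cancel_right] at h₁₁
  have h₁₀ := hdeg (α + 1) 0
  rw [add_zero] at h₁₀
  conv_lhs => rw [← component_add_component α x, ← component_add_component 0 y]
  simp only [zero_add, map_add, LinearMap.add_apply, component_of_mem h₀₀, component_of_mem h₁₁,
    component_of_mem_succ h₁₀, component_of_mem_succ (hdeg α 1), add_zero]

theorem identity_even_left (h : IsLeibniz μ) (x : V₀ × V₁) {y : V₀ × V₁}
    (hy : y ∈ part V₀ V₁ 0) (z : V₀ × V₁) : μ x (μ y z) = μ (μ x y) z - μ (μ x z) y := by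
  have hβ (β : ZMod 2) := h.identity 0 β x y _ hy (component_mem β z)
  simp only [sgn, ZMod.val_zero, zero_mul, pow_zero, one_smul] at hβ
  rw [← component_add_component 0 z]
  simp only [map_add, LinearMap.add_apply, hβ]
  abel

theorem identity_even_right (h : IsLeibniz μ) (x y : V₀ × V₁) {z : V₀ × V₁}
    (hz : z ∈ part V₀ V₁ 0) : μ x (μ y z) = μ (μ x y) z - μ (μ x z) y := by
  have hα (α : ZMod 2) := h.identity α 0 x _ z (component_mem α y) hz
  simp only [sgn, ZMod.val_zero, mul_zero, pow_zero, one_smul] at hα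
  rw [← component_add_component 0 y]
  simp only [map_add, LinearMap.add_apply, hα]
  abel

theorem identity_odd (h : IsLeibniz μ) (x : V₀ × V₁) {y z : V₀ × V₁}
    (hy : y ∈ part V₀ V₁ 1) (hz : z ∈ part V₀ V₁ 1) :
    μ x (μ y z) = μ (μ x y) z + μ (μ x z) y := by
  simpa [sgn, ZMod.val_one] using h.identity 1 1 x y z hy hz

end IsLeibniz

end Identities

section LowerCentral

variable {V₀ V₁ : Type} [AddCommGroup V₀] [Module ℂ V₀] [AddCommGroup V₁] [Module ℂ V₁]
variable {μ : Law V₀ V₁}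

local notation "C" => lowerCentral μ

theorem mul_mem_lowerCentral_succ {k : ℕ} {x : V₀ × V₁} (hx : x ∈ C k) (y : V₀ × V₁) :
    μ x y ∈ C (k + 1) :=
  Submodule.apply_mem_map₂ μ hx Submodule.mem_top

theorem mul_mem_lowerCentral_one (x y : V₀ × V₁) : μ x y ∈ C 1 :=
  mul_mem_lowerCentral_succ (k := 0) Submodule.mem_top y

theorem lowerCentral_succ_le_iff {k : ℕ} {P : Submodule ℂ (V₀ × V₁)} :
    C (k + 1) ≤ P ↔ ∀ x ∈ C k, ∀ y, μ x y ∈ P :=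
  Submodule.map₂_le.trans (by simp only [Submodule.mem_top, true_imp_iff]; rfl)

theorem lowerCentral_succ_le (k : ℕ) : C (k + 1) ≤ C k := by
  induction k with
  | zero => exact le_top
  | succ k ih => exact Submodule.map₂_le_map₂_left ih

theorem lowerCentral_antitone : Antitone (lowerCentral μ) :=
  antitone_nat_of_succ_le lowerCentral_succ_le

theorem lowerCentral_ne_bot_of_le {j k : ℕ} (hjk : j ≤ k) (hk : C k ≠ ⊥) : C j ≠ ⊥ :=
  fun hj => hk (le_bot_iff.1 (hj ▸ lowerCentral_antitone hjk))

namespace IsLeibniz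

theorem component_mem_lowerCentral (h : IsLeibniz μ) {k : ℕ} (α : ZMod 2) {x : V₀ × V₁}
    (hx : x ∈ C k) : component α x ∈ C k := by
  induction k generalizing α x with
  | zero => exact Submodule.mem_top
  | succ k ih =>
    suffices C (k + 1) ≤ (C (k + 1)).comap (component α) from this hx
    refine lowerCentral_succ_le_iff.2 fun x hx y => ?_
    rw [Submodule.mem_comap, h.component_mul]
    exact add_mem (mul_mem_lowerCentral_succ (ih α hx) _) (mul_mem_lowerCentral_succ (ih _ hx) _)

theorem mul_mem_lowerCentral (h : IsLeibniz μ) {i j : ℕ} {x y : V₀ × V₁} (hx : x ∈ C i)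
    (hy : y ∈ C j) : μ x y ∈ C (i + j + 1) := by
  induction j generalizing i x y with
  | zero => exact mul_mem_lowerCentral_succ hx y
  | succ j ih =>
    suffices C (j + 1) ≤ (C (i + (j + 1) + 1)).comap (μ x) from this hy
    refine lowerCentral_succ_le_iff.2 fun a ha b => ?_
    have hom (α β : ZMod 2) : μ x (μ (component α a) (component β b)) ∈ C (i + (j + 1) + 1) := by
      have haα := h.component_mem_lowerCentral α ha
      rw [h.identity α β x _ _ (component_mem α a) (component_mem β b)]
      refine sub_mem (mul_mem_lowerCentral_succ (ih hx haα) _) (Submodule.smul_mem _ _ ?_)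
      rw [show i + (j + 1) + 1 = i + 1 + j + 1 by omega]
      exact ih (mul_mem_lowerCentral_succ hx _) haα
    rw [Submodule.mem_comap, ← component_add_component 0 a, ← component_add_component 0 b]
    simp only [map_add, LinearMap.add_apply]
    exact add_mem (add_mem (hom _ _) (hom _ _)) (add_mem (hom _ _) (hom _ _))

theorem mul_mem_of_le (h : IsLeibniz μ) {i j k : ℕ} {x y : V₀ × V₁} (hx : x ∈ C i)
    (hy : y ∈ C j) (hk : k ≤ i + j + 1) : μ x y ∈ C k :=
  lowerCentral_antitone hk (h.mul_mem_lowerCentral hx hy)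

theorem lowerCentral_succ_le_of_span (h : IsLeibniz μ) {k : ℕ} {S T : Set (V₀ × V₁)}
    {P : Submodule ℂ (V₀ × V₁)} (hS : Submodule.span ℂ S ⊔ C (k + 1) = C k)
    (hT : Submodule.span ℂ T ⊔ C 1 = ⊤) (hP : C (k + 2) ≤ P)
    (hST : ∀ s ∈ S, ∀ t ∈ T, μ s t ∈ P) : C (k + 1) ≤ P := by
  have hSC : Submodule.span ℂ S ≤ C k := hS ▸ le_sup_left
  change Submodule.map₂ μ (C k) ⊤ ≤ P
  rw [← hS, Submodule.map₂_sup_left, ← hT, Submodule.map₂_sup_right, hT]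
  refine sup_le (sup_le ?_ ?_) hP
  · rw [Submodule.map₂_span_span, Submodule.span_le, Set.image2_subset_iff]
    exact hST
  · exact Submodule.map₂_le.2 fun x hx y hy => hP (h.mul_mem_of_le (hSC hx) hy (by omega))

end IsLeibniz

theorem IsNilpotent.lowerCentral_succ_lt (hn : IsNilpotent μ) {k : ℕ} (hk : C k ≠ ⊥) :
    C (k + 1) < C k := by
  refine (lowerCentral_succ_le k).lt_of_ne fun heq => hk ?_
  have hconst (j : ℕ) : C (k + j) = C k := by
    induction j with
    | zero => rfl
    | succ j ih => exact (congrArg (Submodule.map₂ μ · ⊤) ih).trans heq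
  obtain ⟨l, hl⟩ := hn
  exact le_bot_iff.1 (hl ▸ hconst l ▸ lowerCentral_antitone (Nat.le_add_left l k))

theorem IsNilpotent.nilindex_le_iff (hn : IsNilpotent μ) {k : ℕ} :
    nilindex μ ≤ k ↔ C k = ⊥ := by
  refine ⟨fun hk => le_bot_iff.1 ?_, fun hk => Nat.sInf_le hk⟩
  have hmin : C (nilindex μ) = ⊥ := Nat.sInf_mem hn
  exact hmin ▸ lowerCentral_antitone hk

end LowerCentral

section Generators

variable {V₀ V₁ : Type} [AddCommGroup V₀] [Module ℂ V₀] [AddCommGroup V₁] [Module ℂ V₁]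
variable {μ : Law V₀ V₁}

local notation "C" => lowerCentral μ

namespace IsLeibniz

theorem not_part_one_le (h : IsLeibniz μ) (hn : IsNilpotent μ) [Nontrivial V₁] :
    ¬ part V₀ V₁ 1 ≤ C 1 := by
  intro h₁
  have hle (k : ℕ) : part V₀ V₁ 1 ≤ C k := by
    induction k with
    | zero => exact le_top
    | succ k ih =>
      suffices C 1 ≤ (C (k + 1)).comap (component 1) from fun x hx =>
        component_of_mem hx ▸ this (h₁ hx)
      refine lowerCentral_succ_le_iff.2 fun x _ y => ?_
      rw [Submodule.mem_comap, h.component_mul]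
      exact add_mem (mul_mem_lowerCentral_succ (ih (component_mem 1 x)) _)
        (h.mul_mem_of_le (i := 0) Submodule.mem_top (ih (component_mem 1 y)) (by omega))
  obtain ⟨k, hk⟩ := hn
  obtain ⟨v, hv⟩ := exists_ne (0 : V₁)
  have hv₀ : ((0, v) : V₀ × V₁) = 0 := (Submodule.mem_bot ℂ).1 (hk ▸ hle k (mem_part_one.2 rfl))
  exact hv (congrArg Prod.snd hv₀)

theorem component_mem_succ_of_part_zero_le (h : IsLeibniz μ) (h₀ : part V₀ V₁ 0 ≤ C 1) {k : ℕ}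
    {x : V₀ × V₁} (hx : x ∈ C k) : component (k : ZMod 2) x ∈ C (k + 1) := by
  induction k generalizing x with
  | zero => exact h₀ (Nat.cast_zero (R := ZMod 2) ▸ component_mem 0 x)
  | succ k ih =>
    suffices C (k + 1) ≤ (C (k + 2)).comap (component ((k + 1 : ℕ) : ZMod 2)) from this hx
    refine lowerCentral_succ_le_iff.2 fun x hx y => ?_
    have hk : ((k + 1 : ℕ) : ZMod 2) + 1 = k := by
      rw [Nat.cast_succ, CharTwo.add_cancel_right]
    rw [Submodule.mem_comap, h.component_mul, hk]
    exact add_mem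
      (h.mul_mem_lowerCentral (h.component_mem_lowerCentral _ hx) (h₀ (component_mem 0 y)))
      (mul_mem_lowerCentral_succ (ih hx) _)

theorem inf_part_zero_lt_of_part_zero_le (h : IsLeibniz μ) (hn : IsNilpotent μ)
    (h₀ : part V₀ V₁ 0 ≤ C 1) {k : ℕ} (hk : Odd k) (hne : C k ≠ ⊥) :
    C (k + 1) ⊓ part V₀ V₁ 0 < C k ⊓ part V₀ V₁ 0 := by
  refine (inf_le_inf_right _ (lowerCentral_succ_le k)).lt_of_not_ge fun hge => ?_
  refine (hn.lowerCentral_succ_lt hne).not_ge fun x hx => ?_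
  have hx₀ : component 0 x ∈ C (k + 1) :=
    (hge ⟨h.component_mem_lowerCentral 0 hx, component_mem 0 x⟩).1
  have hx₁ : component 1 x ∈ C (k + 1) :=
    hk.natCast_zmod_two ▸ h.component_mem_succ_of_part_zero_le h₀ hx
  exact component_add_component 0 x ▸ add_mem hx₀ hx₁

theorem not_part_zero_le (h : IsLeibniz μ) (hn : IsNilpotent μ) [FiniteDimensional ℂ V₀]
    (hne : C (2 * finrank ℂ V₀ + 1) ≠ ⊥) : ¬ part V₀ V₁ 0 ≤ C 1 := by
  intro h₀
  have : FiniteDimensional ℂ (part V₀ V₁ 0) :=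
    inferInstanceAs (FiniteDimensional ℂ (LinearMap.range (LinearMap.inl ℂ V₀ V₁)))
  have hlt (k : ℕ) (hk : k ≤ finrank ℂ V₀) :
      finrank ℂ ↥(C (2 * k + 2) ⊓ part V₀ V₁ 0) < finrank ℂ ↥(C (2 * k + 1) ⊓ part V₀ V₁ 0) :=
    Submodule.finrank_lt_finrank_of_lt <|
      h.inf_part_zero_lt_of_part_zero_le hn h₀ (odd_two_mul_add_one k)
        (lowerCentral_ne_bot_of_le (by omega) hne)
  have hdim (k : ℕ) (hk : k ≤ finrank ℂ V₀ + 1) :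
      finrank ℂ ↥(C (2 * k + 1) ⊓ part V₀ V₁ 0) + k ≤ finrank ℂ V₀ := by
    induction k with
    | zero => exact (Submodule.finrank_mono inf_le_right).trans finrank_part_zero.le
    | succ k ih =>
      have hle : finrank ℂ ↥(C (2 * (k + 1) + 1) ⊓ part V₀ V₁ 0) ≤
          finrank ℂ ↥(C (2 * k + 2) ⊓ part V₀ V₁ 0) :=
        Submodule.finrank_mono (inf_le_inf_right _ (lowerCentral_succ_le (2 * k + 2)))
      have := hlt k (by omega)
      have := ih (by omega)
      omega
  have := hdim _ le_rfl
  omega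

end IsLeibniz

end Generators

section DimensionCount

theorem covBy_of_finrank_eq_succ {W : Type*} [AddCommGroup W] [Module ℂ W] {A B : Submodule ℂ W}
    [FiniteDimensional ℂ B] (hAB : A ≤ B) (hfin : finrank ℂ B = finrank ℂ A + 1) : A ⋖ B := by
  refine ⟨hAB.lt_of_ne fun h => by subst h; omega, fun D hAD hDB => ?_⟩
  have := Submodule.finrank_lt_finrank_of_lt hDB
  have : FiniteDimensional ℂ D := Submodule.finiteDimensional_of_le hDB.le
  have := Submodule.finrank_lt_finrank_of_lt hAD
  omega

theorem span_singleton_sup_eq_of_covBy {W : Type*} [AddCommGroup W] [Module ℂ W]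
    {A B : Submodule ℂ W} (hAB : A ⋖ B) {z : W} (hzB : z ∈ B) (hzA : z ∉ A) :
    Submodule.span ℂ {z} ⊔ A = B :=
  (hAB.eq_or_eq le_sup_right (sup_le (by simpa using hzB) hAB.le)).resolve_left
    fun h => hzA (h ▸ Submodule.mem_sup_left (Submodule.mem_span_singleton_self z))

variable {V₀ V₁ : Type} [AddCommGroup V₀] [Module ℂ V₀] [AddCommGroup V₁] [Module ℂ V₁]
variable [FiniteDimensional ℂ V₀] [FiniteDimensional ℂ V₁] {μ : Law V₀ V₁} {m : ℕ}

local notation "C" => lowerCentral μ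

theorem IsNilpotent.finrank_lowerCentral_add_le (hn : IsNilpotent μ) (hne : C m ≠ ⊥) {j k : ℕ}
    (hjk : j ≤ k) (hk : k ≤ m + 1) : finrank ℂ (C k) + k ≤ finrank ℂ (C j) + j := by
  induction k, hjk using Nat.le_induction with
  | base => rfl
  | succ k _ ih =>
    have := Submodule.finrank_lt_finrank_of_lt
      (hn.lowerCentral_succ_lt (lowerCentral_ne_bot_of_le (by omega : k ≤ m) hne))
    have := ih (by omega)
    omega

namespace IsLeibniz

theorem finrank_lowerCentral_le (h : IsLeibniz μ) (k : ℕ) :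
    finrank ℂ (C k) ≤
      finrank ℂ ↥(C k ⊓ part V₀ V₁ 0) + finrank ℂ ↥(C k ⊓ part V₀ V₁ 1) := by
  refine (Submodule.finrank_mono fun x hx => ?_).trans
    (Submodule.finrank_add_le_finrank_add_finrank _ _)
  exact component_add_component 0 x ▸ Submodule.add_mem_sup
    ⟨h.component_mem_lowerCentral 0 hx, component_mem 0 x⟩
    ⟨h.component_mem_lowerCentral 1 hx, component_mem 1 x⟩

theorem finrank_lowerCentral_one_inf_part_zero_lt (h : IsLeibniz μ) (hn : IsNilpotent μ)
    (hne : C (2 * finrank ℂ V₀ + 1) ≠ ⊥) :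
    finrank ℂ ↥(C 1 ⊓ part V₀ V₁ 0) < finrank ℂ V₀ :=
  (Submodule.finrank_lt_finrank_of_lt (inf_lt_right.2 (h.not_part_zero_le hn hne))).trans_eq
    finrank_part_zero

theorem finrank_lowerCentral_one_inf_part_one_lt [Nontrivial V₁] (h : IsLeibniz μ)
    (hn : IsNilpotent μ) : finrank ℂ ↥(C 1 ⊓ part V₀ V₁ 1) < finrank ℂ V₁ :=
  (Submodule.finrank_lt_finrank_of_lt (inf_lt_right.2 (h.not_part_one_le hn))).trans_eq
    finrank_part_one

theorem finrank_lowerCentral_one_inf_part_lt (h : IsLeibniz μ) (hn : IsNilpotent μ) (hm : 5 ≤ m)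
    (h₀ : finrank ℂ V₀ = 2) (h₁ : finrank ℂ V₁ = m) (hne : C m ≠ ⊥) :
    finrank ℂ ↥(C 1 ⊓ part V₀ V₁ 0) < 2 ∧ finrank ℂ ↥(C 1 ⊓ part V₀ V₁ 1) < m := by
  have : Nontrivial V₁ := nontrivial_of_finrank_pos (R := ℂ) (by omega)
  exact ⟨(h.finrank_lowerCentral_one_inf_part_zero_lt hn
    (lowerCentral_ne_bot_of_le (k := m) (by omega) hne)).trans_eq h₀,
    (h.finrank_lowerCentral_one_inf_part_one_lt hn).trans_eq h₁⟩

theorem finrank_lowerCentral (h : IsLeibniz μ) (hn : IsNilpotent μ) (hm : 5 ≤ m)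
    (h₀ : finrank ℂ V₀ = 2) (h₁ : finrank ℂ V₁ = m) (hne : C m ≠ ⊥) {k : ℕ} (hk : 1 ≤ k)
    (hkm : k ≤ m + 1) : finrank ℂ (C k) + k = m + 1 := by
  have := h.finrank_lowerCentral_one_inf_part_lt hn hm h₀ h₁ hne
  have := h.finrank_lowerCentral_le 1
  have := hn.finrank_lowerCentral_add_le hne hk hkm
  have := hn.finrank_lowerCentral_add_le hne hkm le_rfl
  omega

end IsLeibniz

end DimensionCount

section Adapted

variable {V₀ V₁ : Type} [AddCommGroup V₀] [Module ℂ V₀] [AddCommGroup V₁] [Module ℂ V₁]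

/-- Leibniz superalgebras generated by one even element `X₀` and one odd element `Y₁`, in which
`X₁` spans the even part of `C¹(L)` and the descending central sequence decreases from `C¹(L)` on
by one dimension at a time, until it vanishes at index `m + 1`. These are the adapted bases of the
superalgebras of type `(2, m)` whose nilindex exceeds `m`. -/
structure IsAdapted (μ : Law V₀ V₁) (m : ℕ) (X₀ X₁ Y₁ : V₀ × V₁) : Prop extends IsLeibniz μ where
  X₀_even : X₀ ∈ part V₀ V₁ 0
  Y₁_odd : Y₁ ∈ part V₀ V₁ 1
  X₁_ne_zero : X₁ ≠ 0
  generate : Submodule.span ℂ {X₀, Y₁} ⊔ lowerCentral μ 1 = ⊤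
  inf_part_zero : lowerCentral μ 1 ⊓ part V₀ V₁ 0 = Submodule.span ℂ {X₁}
  covBy : ∀ k, 1 ≤ k → k ≤ m → lowerCentral μ (k + 1) ⋖ lowerCentral μ k
  succ_eq_bot : lowerCentral μ (m + 1) = ⊥

theorem exists_generators {μ : Law V₀ V₁}
    (h₀ : lowerCentral μ 1 ⊓ part V₀ V₁ 0 ⋖ part V₀ V₁ 0)
    (h₁ : lowerCentral μ 1 ⊓ part V₀ V₁ 1 ⋖ part V₀ V₁ 1) :
    ∃ X₀ ∈ part V₀ V₁ 0, ∃ Y₁ ∈ part V₀ V₁ 1,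
      Submodule.span ℂ {X₀, Y₁} ⊔ lowerCentral μ 1 = ⊤ := by
  obtain ⟨X₀, hX₀, hX₀C⟩ := SetLike.exists_of_lt h₀.lt
  obtain ⟨Y₁, hY₁, hY₁C⟩ := SetLike.exists_of_lt h₁.lt
  refine ⟨X₀, hX₀, Y₁, hY₁, eq_top_iff.2 fun x _ => ?_⟩
  have hle₀ : part V₀ V₁ 0 ≤ Submodule.span ℂ {X₀, Y₁} ⊔ lowerCentral μ 1 :=
    (span_singleton_sup_eq_of_covBy h₀ hX₀ hX₀C).ge.trans
      (sup_le_sup (Submodule.span_mono (by simp)) inf_le_left)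
  have hle₁ : part V₀ V₁ 1 ≤ Submodule.span ℂ {X₀, Y₁} ⊔ lowerCentral μ 1 :=
    (span_singleton_sup_eq_of_covBy h₁ hY₁ hY₁C).ge.trans
      (sup_le_sup (Submodule.span_mono (by simp)) inf_le_left)
  exact component_add_component 0 x ▸
    add_mem (hle₀ (component_mem 0 x)) (hle₁ (component_mem 1 x))

theorem IsLeibniz.exists_isAdapted [FiniteDimensional ℂ V₀] [FiniteDimensional ℂ V₁]
    {μ : Law V₀ V₁} (h : IsLeibniz μ) (hn : IsNilpotent μ) {m : ℕ} (hm : 5 ≤ m)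
    (h₀ : finrank ℂ V₀ = 2) (h₁ : finrank ℂ V₁ = m) (hne : lowerCentral μ m ≠ ⊥) :
    ∃ X₀ X₁ Y₁, IsAdapted μ m X₀ X₁ Y₁ := by
  have hrank {k : ℕ} := h.finrank_lowerCentral hn hm h₀ h₁ hne (k := k)
  have hC := h.finrank_lowerCentral_one_inf_part_lt hn hm h₀ h₁ hne
  have hsum := h.finrank_lowerCentral_le 1
  have hrank₁ := hrank le_rfl (by omega)
  have hL₀ : finrank ℂ (part V₀ V₁ 0) = 2 := finrank_part_zero.trans h₀
  have hL₁ : finrank ℂ (part V₀ V₁ 1) = m := finrank_part_one.trans h₁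
  obtain ⟨⟨X₁, hX₁⟩, hX₁0, hspan⟩ := finrank_eq_one_iff'.1
    (show finrank ℂ ↥(lowerCentral μ 1 ⊓ part V₀ V₁ 0) = 1 by omega)
  obtain ⟨X₀, hX₀, Y₁, hY₁, hgen⟩ := exists_generators
    (covBy_of_finrank_eq_succ inf_le_right (by omega) :
      lowerCentral μ 1 ⊓ part V₀ V₁ 0 ⋖ part V₀ V₁ 0)
    (covBy_of_finrank_eq_succ inf_le_right (by omega))
  refine ⟨X₀, X₁, Y₁, h, hX₀, hY₁, by simpa using hX₁0, hgen, ?_, fun k hk hkm => ?_, ?_⟩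
  · refine le_antisymm (fun x hx => ?_) ((Submodule.span_singleton_le_iff_mem _ _).2 hX₁)
    obtain ⟨c, hc⟩ := hspan ⟨x, hx⟩
    exact Submodule.mem_span_singleton.2 ⟨c, congrArg Subtype.val hc⟩
  · have := hrank hk (by omega)
    have := hrank (k := k + 1) (by omega) (by omega)
    exact covBy_of_finrank_eq_succ (lowerCentral_succ_le k) (by omega)
  · have := hrank (k := m + 1) (by omega) le_rfl
    exact Submodule.finrank_eq_zero.1 (by omega)

end Adapted

section AdaptedLemmas

variable {V₀ V₁ : Type} [AddCommGroup V₀] [Module ℂ V₀] [AddCommGroup V₁] [Module ℂ V₁]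
variable {μ : Law V₀ V₁} {m : ℕ} {X₀ X₁ Y₁ : V₀ × V₁}

local notation "C" => lowerCentral μ

namespace IsAdapted

theorem lowerCentral_eq_bot (A : IsAdapted μ m X₀ X₁ Y₁) {k : ℕ} (hk : m + 1 ≤ k) : C k = ⊥ :=
  le_bot_iff.1 ((lowerCentral_antitone hk).trans A.succ_eq_bot.le)

theorem eq_zero_of_mem (A : IsAdapted μ m X₀ X₁ Y₁) {k : ℕ} (hk : m + 1 ≤ k) {x : V₀ × V₁}
    (hx : x ∈ C k) : x = 0 :=
  (Submodule.mem_bot ℂ).1 (A.lowerCentral_eq_bot hk ▸ hx)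

theorem X₁_mem (A : IsAdapted μ m X₀ X₁ Y₁) : X₁ ∈ C 1 ⊓ part V₀ V₁ 0 :=
  A.inf_part_zero ▸ Submodule.mem_span_singleton_self X₁

theorem exists_smul_eq (A : IsAdapted μ m X₀ X₁ Y₁) {x : V₀ × V₁} (hx : x ∈ C 1)
    (hx₀ : x ∈ part V₀ V₁ 0) : ∃ a : ℂ, a • X₁ = x :=
  Submodule.mem_span_singleton.1 (A.inf_part_zero ▸ ⟨hx, hx₀⟩)

theorem even_mem (A : IsAdapted μ m X₀ X₁ Y₁) {k : ℕ} (hX : X₁ ∈ C k) {x : V₀ × V₁}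
    (hx : x ∈ C 1) (hx₀ : x ∈ part V₀ V₁ 0) : x ∈ C k := by
  obtain ⟨a, rfl⟩ := A.exists_smul_eq hx hx₀
  exact Submodule.smul_mem _ a hX

theorem even_eq_zero (A : IsAdapted μ m X₀ X₁ Y₁) {k : ℕ} (hk : 1 ≤ k) (hX : X₁ ∉ C k)
    {x : V₀ × V₁} (hx : x ∈ C k) (hx₀ : x ∈ part V₀ V₁ 0) : x = 0 := by
  obtain ⟨a, rfl⟩ := A.exists_smul_eq (lowerCentral_antitone hk hx) hx₀
  by_contra ha
  exact hX (((C k).smul_mem_iff (left_ne_zero_of_smul ha)).1 hx)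

theorem odd_mem_succ (A : IsAdapted μ m X₀ X₁ Y₁) {k : ℕ} (hk : 1 ≤ k) (hkm : k ≤ m)
    (hX : X₁ ∈ C k) (hX' : X₁ ∉ C (k + 1)) {x : V₀ × V₁} (hx : x ∈ C k)
    (hx₁ : x ∈ part V₀ V₁ 1) : x ∈ C (k + 1) := by
  rw [← span_singleton_sup_eq_of_covBy (A.covBy k hk hkm) hX hX'] at hx
  obtain ⟨_, hp, r, hr, rfl⟩ := Submodule.mem_sup.1 hx
  obtain ⟨a, rfl⟩ := Submodule.mem_span_singleton.1 hp
  have hX₁ : component 1 X₁ = 0 := component_of_mem_succ A.X₁_mem.2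
  rw [← component_of_mem hx₁, map_add, map_smul, hX₁, smul_zero, zero_add]
  exact A.component_mem_lowerCentral 1 hr

theorem mul_Y₁_notMem (A : IsAdapted μ m X₀ X₁ Y₁) {k : ℕ} (hk : 1 ≤ k) (hkm : k + 1 ≤ m)
    {z : V₀ × V₁} (hz : z ∈ C k) (hz' : z ∉ C (k + 1)) (hX₀ : μ z X₀ ∈ C (k + 2)) :
    μ z Y₁ ∉ C (k + 2) := by
  intro hY₁
  refine (A.covBy (k + 1) (by omega) hkm).lt.not_ge <| A.lowerCentral_succ_le_of_span
    (span_singleton_sup_eq_of_covBy (A.covBy k hk (by omega)) hz hz') A.generate le_rfl ?_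
  rintro _ rfl _ (rfl | rfl)
  exacts [hX₀, hY₁]

theorem mul_X₁_Y₁_notMem (A : IsAdapted μ m X₀ X₁ Y₁) {k : ℕ} (hk : 1 ≤ k) (hkm : k + 1 ≤ m)
    (hX : X₁ ∈ C k) (hX' : X₁ ∉ C (k + 1)) : μ X₁ Y₁ ∉ C (k + 2) := by
  refine A.mul_Y₁_notMem hk hkm hX hX' ?_
  rw [A.even_eq_zero (by omega) hX' (mul_mem_lowerCentral_succ hX X₀)
    (A.grading 0 0 _ _ A.X₁_mem.2 A.X₀_even)]
  exact zero_mem _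

theorem X₁_mem_two (A : IsAdapted μ m X₀ X₁ Y₁) (hm : 3 ≤ m) : X₁ ∈ C 2 := by
  by_contra hX
  have hX₁ := A.X₁_mem
  have hX₁X₀ : μ X₁ X₀ = 0 := A.even_eq_zero (k := 2) (by omega) hX
    (mul_mem_lowerCentral_succ hX₁.1 X₀) (A.grading 0 0 _ _ hX₁.2 A.X₀_even)
  have hu : μ X₁ Y₁ ∈ C 2 := mul_mem_lowerCentral_succ hX₁.1 Y₁
  have huX₀ : μ (μ X₁ Y₁) X₀ ∈ C 4 := by
    have hY₁X₀ : μ Y₁ X₀ ∈ C 2 := A.odd_mem_succ le_rfl (by omega) hX₁.1 hX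
      (mul_mem_lowerCentral_one _ X₀) (A.grading 1 0 _ _ A.Y₁_odd A.X₀_even)
    have hid := A.identity_even_right X₁ Y₁ A.X₀_even
    rw [hX₁X₀, map_zero, LinearMap.zero_apply, sub_zero] at hid
    rw [← hid]
    exact A.mul_mem_of_le hX₁.1 hY₁X₀ (by omega)
  have huY₁ : μ (μ X₁ Y₁) Y₁ = 0 :=
    A.even_eq_zero (k := 3) (by omega) (fun h => hX (lowerCentral_succ_le 2 h))
      (mul_mem_lowerCentral_succ hu Y₁)
      (A.grading 1 1 _ _ (A.grading 0 1 _ _ hX₁.2 A.Y₁_odd) A.Y₁_odd)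
  exact A.mul_Y₁_notMem (by omega) hm hu (A.mul_X₁_Y₁_notMem le_rfl (by omega) hX₁.1 hX) huX₀
    (huY₁ ▸ zero_mem _)

theorem exists_odd_notMem (A : IsAdapted μ m X₀ X₁ Y₁) {k : ℕ} (hk : 1 ≤ k) (hkm : k ≤ m)
    (hX : X₁ ∈ C (k + 1)) : ∃ z ∈ part V₀ V₁ 1, z ∈ C k ∧ z ∉ C (k + 1) := by
  obtain ⟨z, hz, hz'⟩ := SetLike.exists_of_lt (A.covBy k hk hkm).lt
  have hz₀ : component 0 z ∈ C (k + 1) := A.even_mem hX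
    (lowerCentral_antitone hk (A.component_mem_lowerCentral 0 hz)) (component_mem 0 z)
  exact ⟨component 1 z, component_mem 1 z, A.component_mem_lowerCentral 1 hz, fun hz₁ =>
    hz' (component_add_component 0 z ▸ add_mem hz₀ hz₁)⟩

theorem X₁_mem_succ (A : IsAdapted μ m X₀ X₁ Y₁) {k : ℕ} (hk : 1 ≤ k) (hkm : k + 2 ≤ m)
    (hX : X₁ ∈ C (k + 1)) : X₁ ∈ C (k + 2) := by
  by_contra hX'
  obtain ⟨z, hz₁, hz, hz'⟩ := A.exists_odd_notMem hk (by omega) hX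
  have hzX₀ : μ z X₀ ∈ C (k + 2) := A.odd_mem_succ (by omega) (by omega) hX hX'
    (mul_mem_lowerCentral_succ hz X₀) (A.grading 1 0 _ _ hz₁ A.X₀_even)
  have hzY₁ := A.mul_Y₁_notMem hk (by omega) hz hz' hzX₀
  obtain ⟨b, hb⟩ := A.exists_smul_eq (lowerCentral_antitone (by omega)
    (mul_mem_lowerCentral_succ hz Y₁)) (A.grading 1 1 _ _ hz₁ A.Y₁_odd)
  have hb₀ : b ≠ 0 := by
    rintro rfl
    exact hzY₁ (hb ▸ zero_smul ℂ X₁ ▸ zero_mem _)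
  have hY₁Y₁ : μ Y₁ Y₁ ∈ C (k + 1) := A.even_mem hX (mul_mem_lowerCentral_one _ Y₁)
    (A.grading 1 1 _ _ A.Y₁_odd A.Y₁_odd)
  have hsq : μ z (μ Y₁ Y₁) = (2 * b) • μ X₁ Y₁ := by
    rw [A.identity_odd z A.Y₁_odd A.Y₁_odd, ← hb, map_smul, LinearMap.smul_apply, two_mul,
      add_smul]
  refine A.mul_X₁_Y₁_notMem (by omega) (by omega) hX hX' <|
    ((C (k + 3)).smul_mem_iff (mul_ne_zero two_ne_zero hb₀)).1 ?_
  exact hsq ▸ A.mul_mem_of_le hz hY₁Y₁ (by omega)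

theorem X₁_mem_last (A : IsAdapted μ m X₀ X₁ Y₁) (hm : 3 ≤ m) : X₁ ∈ C m := by
  have hmem (k : ℕ) (hkm : k + 2 ≤ m) : X₁ ∈ C (k + 2) := by
    induction k with
    | zero => exact A.X₁_mem_two hm
    | succ k ih => exact A.X₁_mem_succ (by omega) hkm (ih (by omega))
  obtain ⟨k, rfl⟩ := Nat.exists_eq_add_of_le' (by omega : 2 ≤ m)
  exact hmem k le_rfl

theorem mul_even_eq_zero (A : IsAdapted μ m X₀ X₁ Y₁) (hm : 3 ≤ m) (x : V₀ × V₁)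
    {y : V₀ × V₁} (hy : y ∈ C 1) (hy₀ : y ∈ part V₀ V₁ 0) : μ x y = 0 :=
  A.eq_zero_of_mem le_rfl <| A.mul_mem_of_le (i := 0) Submodule.mem_top
    (A.even_mem (A.X₁_mem_last hm) hy hy₀) (by omega)

theorem even_mul_eq_zero (A : IsAdapted μ m X₀ X₁ Y₁) (hm : 3 ≤ m) {x : V₀ × V₁}
    (hx : x ∈ C 1) (hx₀ : x ∈ part V₀ V₁ 0) (y : V₀ × V₁) : μ x y = 0 :=
  A.eq_zero_of_mem le_rfl <|
    mul_mem_lowerCentral_succ (A.even_mem (A.X₁_mem_last hm) hx hx₀) y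

theorem odd_eq_zero (A : IsAdapted μ m X₀ X₁ Y₁) (hm : 3 ≤ m) {x : V₀ × V₁} (hx : x ∈ C m)
    (hx₁ : x ∈ part V₀ V₁ 1) : x = 0 :=
  A.eq_zero_of_mem le_rfl <| A.odd_mem_succ (by omega) le_rfl (A.X₁_mem_last hm)
    (fun h => A.X₁_ne_zero (A.eq_zero_of_mem le_rfl h)) hx hx₁

end IsAdapted

end AdaptedLemmas

section Parity

variable {V₀ V₁ : Type} [AddCommGroup V₀] [Module ℂ V₀] [AddCommGroup V₁] [Module ℂ V₁]
variable {μ : Law V₀ V₁} {m : ℕ} {X₀ X₁ Y₁ : V₀ × V₁}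

local notation "C" => lowerCentral μ

namespace IsAdapted

theorem mul_X₀_notMem (A : IsAdapted μ m X₀ X₁ Y₁) {k : ℕ} (hk : 1 ≤ k) (hkm : k + 2 ≤ m)
    {z : V₀ × V₁} (hz : z ∈ C k) (hz' : z ∉ C (k + 1)) : μ z X₀ ∉ C (k + 2) := by
  refine fun hX₀ => A.mul_Y₁_notMem hk (by omega) hz hz' hX₀ ?_
  have hzC (α : ZMod 2) : component α z ∈ C k := A.component_mem_lowerCentral α hz
  rw [← component_add_component 0 z, map_add, LinearMap.add_apply, A.even_mul_eq_zero (by omega)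
    (lowerCentral_antitone hk (hzC 0)) (component_mem 0 z), zero_add]
  exact A.even_mem (lowerCentral_antitone hkm (A.X₁_mem_last (by omega)))
    (lowerCentral_antitone (by omega) (mul_mem_lowerCentral_succ (hzC 1) Y₁))
    (A.grading 1 1 _ _ (component_mem 1 z) A.Y₁_odd)

theorem mul_X₀_X₀_left (A : IsAdapted μ m X₀ X₁ Y₁) (hm : 3 ≤ m) (y : V₀ × V₁) :
    μ X₀ (μ y X₀) = μ (μ X₀ y) X₀ := by
  rw [A.identity_even_right X₀ y A.X₀_even, A.even_mul_eq_zero hm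
    (mul_mem_lowerCentral_one _ X₀) (A.grading 0 0 _ _ A.X₀_even A.X₀_even), sub_zero]

theorem mul_Y₁_X₀_notMem (A : IsAdapted μ m X₀ X₁ Y₁) (hm : 3 ≤ m) : μ Y₁ X₀ ∉ C 2 := by
  intro hY₁X₀
  have hX₀Y₁ : μ X₀ Y₁ ∉ C 2 := fun hX₀Y₁ => by
    refine (A.covBy 1 le_rfl (by omega)).lt.not_ge <|
      A.lowerCentral_succ_le_of_span (k := 0) A.generate A.generate le_rfl ?_
    have hmem {y : V₀ × V₁} (hy : μ y y ∈ part V₀ V₁ 0) : μ y y ∈ C 2 :=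
      A.even_mem (A.X₁_mem_two hm) (mul_mem_lowerCentral_one _ y) hy
    rintro _ (rfl | rfl) _ (rfl | rfl)
    exacts [hmem (A.grading 0 0 _ _ A.X₀_even A.X₀_even), hX₀Y₁, hY₁X₀,
      hmem (A.grading 1 1 _ _ A.Y₁_odd A.Y₁_odd)]
  refine A.mul_X₀_notMem le_rfl hm (mul_mem_lowerCentral_one _ Y₁) hX₀Y₁ ?_
  rw [← A.mul_X₀_X₀_left hm]
  exact A.mul_mem_of_le (i := 0) Submodule.mem_top hY₁X₀ le_rfl

theorem odd_mul_odd_mem (A : IsAdapted μ m X₀ X₁ Y₁) {y z : V₀ × V₁}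
    (hy : y ∈ part V₀ V₁ 1) (hz : z ∈ part V₀ V₁ 1) : μ y z ∈ C 1 ⊓ part V₀ V₁ 0 :=
  ⟨mul_mem_lowerCentral_one _ z, A.grading 1 1 _ _ hy hz⟩

theorem mul_X₀_mul (A : IsAdapted μ m X₀ X₁ Y₁) (hm : 3 ≤ m) {y z : V₀ × V₁}
    (hy : y ∈ part V₀ V₁ 1) (hz : z ∈ part V₀ V₁ 1) : μ (μ y X₀) z = -μ y (μ z X₀) := by
  have hyz := A.odd_mul_odd_mem hy hz
  rw [A.identity_even_right y z A.X₀_even, A.even_mul_eq_zero hm hyz.1 hyz.2, zero_sub, neg_neg]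

theorem mul_mul_X₀ (A : IsAdapted μ m X₀ X₁ Y₁) (hm : 3 ≤ m) {y z : V₀ × V₁}
    (hy : y ∈ part V₀ V₁ 1) (hz : z ∈ part V₀ V₁ 1) : μ y (μ X₀ z) = μ (μ y X₀) z := by
  have hyz := A.odd_mul_odd_mem hy hz
  rw [A.identity_even_left y A.X₀_even z, A.even_mul_eq_zero hm hyz.1 hyz.2, sub_zero]

theorem X₀_mul_mul (A : IsAdapted μ m X₀ X₁ Y₁) (hm : 3 ≤ m) {y z : V₀ × V₁}
    (hy : y ∈ part V₀ V₁ 1) (hz : z ∈ part V₀ V₁ 1) : μ (μ X₀ y) z = -μ (μ X₀ z) y := by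
  have hyz := A.odd_mul_odd_mem hy hz
  rw [eq_neg_iff_add_eq_zero, ← A.identity_odd X₀ hy hz, A.mul_even_eq_zero hm X₀ hyz.1 hyz.2]

theorem pow_mem_part_one (A : IsAdapted μ m X₀ X₁ Y₁) (k : ℕ) {y : V₀ × V₁}
    (hy : y ∈ part V₀ V₁ 1) : (μ.flip X₀ ^ k) y ∈ part V₀ V₁ 1 :=
  Module.End.pow_apply_mem_of_forall_mem k (fun x hx => A.grading 1 0 x _ hx A.X₀_even) y hy

theorem pow_mem_lowerCentral {j : ℕ} (k : ℕ) {y : V₀ × V₁} (hy : y ∈ C j) :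
    (μ.flip X₀ ^ k) y ∈ C (j + k) := by
  induction k with
  | zero => exact hy
  | succ k ih =>
    rw [pow_succ', Module.End.mul_apply]
    exact mul_mem_lowerCentral_succ ih X₀

theorem pow_notMem (A : IsAdapted μ m X₀ X₁ Y₁) {j k : ℕ} (hj : 1 ≤ j) (hjk : j + k + 1 ≤ m)
    {y : V₀ × V₁} (hy : y ∈ C j) (hy' : y ∉ C (j + 1)) :
    (μ.flip X₀ ^ k) y ∉ C (j + k + 1) := by
  induction k with
  | zero => exact hy'
  | succ k ih =>
    rw [pow_succ', Module.End.mul_apply]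
    exact A.mul_X₀_notMem (k := j + k) (by omega) hjk (pow_mem_lowerCentral k hy) (ih (by omega))

theorem pow_apply_mul (A : IsAdapted μ m X₀ X₁ Y₁) (hm : 3 ≤ m) (k : ℕ) {y z : V₀ × V₁}
    (hy : y ∈ part V₀ V₁ 1) (hz : z ∈ part V₀ V₁ 1) :
    μ ((μ.flip X₀ ^ k) y) z = (-1 : ℂ) ^ k • μ y ((μ.flip X₀ ^ k) z) := by
  induction k generalizing z with
  | zero => simp
  | succ k ih =>
    calc μ ((μ.flip X₀ ^ (k + 1)) y) z
        = -μ ((μ.flip X₀ ^ k) y) (μ z X₀) := by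
          rw [pow_succ', Module.End.mul_apply]
          exact A.mul_X₀_mul hm (A.pow_mem_part_one k hy) hz
      _ = -((-1 : ℂ) ^ k • μ y ((μ.flip X₀ ^ k) (μ z X₀))) := by
          rw [ih (A.grading 1 0 _ _ hz A.X₀_even)]
      _ = (-1 : ℂ) ^ (k + 1) • μ y ((μ.flip X₀ ^ (k + 1)) z) := by
          rw [pow_succ (μ.flip X₀), Module.End.mul_apply, LinearMap.flip_apply, pow_succ,
            mul_neg_one, neg_smul]

theorem X₀_mul_pow (A : IsAdapted μ m X₀ X₁ Y₁) (hm : 3 ≤ m) (k : ℕ) (y : V₀ × V₁) :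
    μ X₀ ((μ.flip X₀ ^ k) y) = (μ.flip X₀ ^ k) (μ X₀ y) :=
  DFunLike.congr_fun (Commute.pow_right (LinearMap.ext (A.mul_X₀_X₀_left hm) :
    Commute (μ X₀) (μ.flip X₀)) k) y

theorem mul_Y₁_ne_zero {k : ℕ} (A : IsAdapted μ (k + 1) X₀ X₁ Y₁) (hk : 2 ≤ k) {z : V₀ × V₁}
    (hz₁ : z ∈ part V₀ V₁ 1) (hz : z ∈ C k) (hz' : z ∉ C (k + 1)) : μ z Y₁ ≠ 0 := by
  have hzX₀ : μ z X₀ = 0 := A.odd_eq_zero (by omega) (mul_mem_lowerCentral_succ hz X₀)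
    (A.grading 1 0 _ _ hz₁ A.X₀_even)
  exact fun hzY₁ => A.mul_Y₁_notMem (by omega) le_rfl hz hz' (hzX₀ ▸ zero_mem _)
    (hzY₁ ▸ zero_mem _)

theorem pow_mul_Y₁_ne_zero {n : ℕ} (A : IsAdapted μ (n + 2) X₀ X₁ Y₁) (hn : 1 ≤ n)
    {y : V₀ × V₁} (hy : y ∈ part V₀ V₁ 1) (hy₁ : y ∈ C 1) (hy₂ : y ∉ C 2) :
    μ ((μ.flip X₀ ^ n) y) Y₁ ≠ 0 := by
  have hmem := pow_mem_lowerCentral (X₀ := X₀) n hy₁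
  have hnotMem := A.pow_notMem le_rfl (k := n) (by omega) hy₁ hy₂
  rw [Nat.add_comm 1 n] at hmem hnotMem
  exact A.mul_Y₁_ne_zero (by omega) (A.pow_mem_part_one n hy) hmem hnotMem

theorem odd_of_add_two {n : ℕ} (A : IsAdapted μ (n + 2) X₀ X₁ Y₁) (hn : 1 ≤ n) : Odd n := by
  have hm : 3 ≤ n + 2 := by omega
  have hY := A.Y₁_odd
  have hXY : μ X₀ Y₁ ∈ part V₀ V₁ 1 := A.grading 0 1 _ _ A.X₀_even hY
  have hXY₁ : μ X₀ Y₁ ∈ C 1 := mul_mem_lowerCentral_one _ Y₁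
  have hYX : μ Y₁ X₀ ∈ part V₀ V₁ 1 := A.grading 1 0 _ _ hY A.X₀_even
  have hYX₁ : μ Y₁ X₀ ∈ C 1 := mul_mem_lowerCentral_one _ X₀
  have he : (μ.flip X₀ ^ n) Y₁ ∈ part V₀ V₁ 1 := A.pow_mem_part_one n hY
  have heXY : μ ((μ.flip X₀ ^ n) Y₁) (μ X₀ Y₁) ≠ 0 := by
    have hcomm : μ ((μ.flip X₀ ^ n) Y₁) X₀ = (μ.flip X₀ ^ n) (μ Y₁ X₀) :=
      DFunLike.congr_fun (pow_mul_comm' (μ.flip X₀) n).symm Y₁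
    rw [A.mul_mul_X₀ hm he hY, hcomm]
    exact A.pow_mul_Y₁_ne_zero hn hYX hYX₁ (A.mul_Y₁_X₀_notMem hm)
  have hXY₂ : μ X₀ Y₁ ∉ C 2 := fun h => heXY <| A.eq_zero_of_mem (k := n + 3) le_rfl <|
    A.mul_mem_of_le (pow_mem_lowerCentral (j := 0) n Submodule.mem_top) h (by omega)
  have hne : μ (μ X₀ ((μ.flip X₀ ^ n) Y₁)) Y₁ ≠ 0 := by
    rw [A.X₀_mul_pow hm]
    exact A.pow_mul_Y₁_ne_zero hn hXY hXY₁ hXY₂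
  have hsign : μ (μ X₀ ((μ.flip X₀ ^ n) Y₁)) Y₁ =
      (-1 : ℂ) ^ n • -μ (μ X₀ ((μ.flip X₀ ^ n) Y₁)) Y₁ :=
    calc μ (μ X₀ ((μ.flip X₀ ^ n) Y₁)) Y₁
        = (-1 : ℂ) ^ n • μ (μ X₀ Y₁) ((μ.flip X₀ ^ n) Y₁) := by
          rw [A.X₀_mul_pow hm, A.pow_apply_mul hm n hXY hY]
      _ = (-1 : ℂ) ^ n • -μ (μ X₀ ((μ.flip X₀ ^ n) Y₁)) Y₁ := by rw [A.X₀_mul_mul hm hY he]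
  have : IsAddTorsionFree (V₀ × V₁) := .of_isTorsionFree ℂ _
  refine Nat.not_even_iff_odd.1 fun heven => hne ?_
  rwa [heven.neg_one_pow, one_smul, self_eq_neg] at hsign

end IsAdapted

theorem IsLeibniz.lowerCentral_succ_eq_bot [FiniteDimensional ℂ V₀] [FiniteDimensional ℂ V₁]
    (h : IsLeibniz μ) (hn : IsNilpotent μ) (hm : 5 ≤ m) (h₀ : finrank ℂ V₀ = 2)
    (h₁ : finrank ℂ V₁ = m) : C (m + 1) = ⊥ := by
  by_contra hne
  obtain ⟨X₀, X₁, Y₁, A⟩ := h.exists_isAdapted hn hm h₀ h₁ (lowerCentral_ne_bot_of_le m.le_succ hne)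
  exact hne A.succ_eq_bot

theorem IsLeibniz.lowerCentral_eq_bot_of_even [FiniteDimensional ℂ V₀] [FiniteDimensional ℂ V₁]
    (h : IsLeibniz μ) (hn : IsNilpotent μ) (hm : 5 ≤ m) (heven : Even m)
    (h₀ : finrank ℂ V₀ = 2) (h₁ : finrank ℂ V₁ = m) : C m = ⊥ := by
  by_contra hne
  obtain ⟨X₀, X₁, Y₁, A⟩ := h.exists_isAdapted hn hm h₀ h₁ hne
  obtain ⟨n, rfl⟩ := Nat.exists_eq_add_of_le' (by omega : 2 ≤ m)
  exact Nat.not_even_iff_odd.2 (A.odd_of_add_two (by omega)) (by simpa [parity_simps] using heven)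

end Parity

section Homomorphisms

variable {V₀ V₁ : Type} [AddCommGroup V₀] [Module ℂ V₀] [AddCommGroup V₁] [Module ℂ V₁]
variable {W₀ W₁ : Type} [AddCommGroup W₀] [Module ℂ W₀] [AddCommGroup W₁] [Module ℂ W₁]
variable {μ : Law V₀ V₁} {ν : Law W₀ W₁}

theorem rightSeq_le_comap {F : (V₀ × V₁) →ₗ[ℂ] (W₀ × W₁)}
    (hF : ∀ x y, F (μ x y) = ν (F x) (F y)) {A B : Submodule ℂ (V₀ × V₁)}
    {A' B' : Submodule ℂ (W₀ × W₁)} (hA : A ≤ A'.comap F) (hB : B ≤ B'.comap F) (k : ℕ) :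
    rightSeq μ A B k ≤ (rightSeq ν A' B' k).comap F := by
  induction k with
  | zero => exact hA
  | succ k ih =>
    refine Submodule.map₂_le.2 fun x hx y hy => ?_
    rw [Submodule.mem_comap, hF]
    exact Submodule.apply_mem_map₂ ν (ih hx) (hB hy)

theorem map_mem_lowerCentral {F : (V₀ × V₁) →ₗ[ℂ] (W₀ × W₁)}
    (hF : ∀ x y, F (μ x y) = ν (F x) (F y)) {k : ℕ} {x : V₀ × V₁} (hx : x ∈ lowerCentral μ k) :
    F x ∈ lowerCentral ν k :=
  rightSeq_le_comap hF le_top le_top k hx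

theorem rightSeq_eq_bot_of_injective {F : (V₀ × V₁) →ₗ[ℂ] (W₀ × W₁)} (hinj : Function.Injective F)
    (hF : ∀ x y, F (μ x y) = ν (F x) (F y)) {A B : Submodule ℂ (V₀ × V₁)}
    {A' B' : Submodule ℂ (W₀ × W₁)} (hA : A ≤ A'.comap F) (hB : B ≤ B'.comap F) {k : ℕ}
    (hk : rightSeq ν A' B' k = ⊥) : rightSeq μ A B k = ⊥ := by
  have hle := rightSeq_le_comap hF hA hB k
  rwa [hk, Submodule.comap_bot, LinearMap.ker_eq_bot.2 hinj, le_bot_iff] at hle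

theorem prodCongr_mem_part (f₀ : V₀ ≃ₗ[ℂ] W₀) (f₁ : V₁ ≃ₗ[ℂ] W₁) {α : ZMod 2} {x : V₀ × V₁} :
    f₀.prodCongr f₁ x ∈ part W₀ W₁ α ↔ x ∈ part V₀ V₁ α := by
  obtain rfl | rfl := eq_zero_or_eq_one α
  · simp [mem_part_zero]
  · simp [mem_part_one]

namespace Isomorphic

theorem symm (h : Isomorphic μ ν) : Isomorphic ν μ := by
  obtain ⟨f₀, f₁, hf⟩ := h
  refine ⟨f₀.symm, f₁.symm, fun x y => (f₀.prodCongr f₁).injective ?_⟩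
  rw [hf]
  simp

theorem isLeibniz (h : Isomorphic μ ν) (hν : IsLeibniz ν) : IsLeibniz μ := by
  obtain ⟨f₀, f₁, hf⟩ := h
  refine ⟨fun α β x y hx hy => ?_, fun α β x y z hy hz => (f₀.prodCongr f₁).injective ?_⟩
  · rw [← prodCongr_mem_part f₀ f₁] at hx hy ⊢
    exact hf x y ▸ hν.grading α β _ _ hx hy
  · rw [← prodCongr_mem_part f₀ f₁] at hy hz
    simp only [map_sub, map_smul, hf]
    exact hν.identity α β _ _ _ hy hz

theorem lowerCentral_eq_bot_iff (h : Isomorphic μ ν) {k : ℕ} :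
    lowerCentral μ k = ⊥ ↔ lowerCentral ν k = ⊥ := by
  obtain ⟨g₀, g₁, hg⟩ := h.symm
  obtain ⟨f₀, f₁, hf⟩ := h
  exact ⟨rightSeq_eq_bot_of_injective (F := (g₀.prodCongr g₁).toLinearMap)
      (g₀.prodCongr g₁).injective hg le_top le_top,
    rightSeq_eq_bot_of_injective (F := (f₀.prodCongr f₁).toLinearMap)
      (f₀.prodCongr f₁).injective hf le_top le_top⟩

theorem isNilpotent (h : Isomorphic μ ν) (hν : IsNilpotent ν) : IsNilpotent μ :=
  hν.imp fun _ => h.lowerCentral_eq_bot_iff.2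

theorem partCentral_eq_bot (h : Isomorphic μ ν) {α : ZMod 2} {k : ℕ}
    (hk : partCentral ν α k = ⊥) : partCentral μ α k = ⊥ := by
  obtain ⟨f₀, f₁, hf⟩ := h
  exact rightSeq_eq_bot_of_injective (F := (f₀.prodCongr f₁).toLinearMap)
    (f₀.prodCongr f₁).injective hf (fun _ => (prodCongr_mem_part f₀ f₁).2)
    (fun _ => (prodCongr_mem_part f₀ f₁).2) hk

end Isomorphic

theorem exists_isomorphic_stdLaw [FiniteDimensional ℂ W₀] [FiniteDimensional ℂ W₁] {n m : ℕ}
    (ν : Law W₀ W₁) (hn : finrank ℂ W₀ = n) (hm : finrank ℂ W₁ = m) :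
    ∃ μ : StdLaw n m, Isomorphic μ ν := by
  let f₀ : (Fin n → ℂ) ≃ₗ[ℂ] W₀ := (finBasisOfFinrankEq ℂ W₀ hn).equivFun.symm
  let f₁ : (Fin m → ℂ) ≃ₗ[ℂ] W₁ := (finBasisOfFinrankEq ℂ W₁ hm).equivFun.symm
  let F := f₀.prodCongr f₁
  exact ⟨(ν.compl₁₂ F.toLinearMap F.toLinearMap).compr₂ F.symm.toLinearMap, f₀, f₁,
    fun x y => F.apply_symm_apply (ν (F x) (F y))⟩

end Homomorphisms

section DirectSum

variable {V₀ V₁ : Type} [AddCommGroup V₀] [Module ℂ V₀] [AddCommGroup V₁] [Module ℂ V₁]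
variable {W₀ W₁ : Type} [AddCommGroup W₀] [Module ℂ W₀] [AddCommGroup W₁] [Module ℂ W₁]
variable {μ : Law V₀ V₁} {ν : Law W₀ W₁}

theorem mem_part_prod {α : ZMod 2} {x : (V₀ × W₀) × (V₁ × W₁)} :
    x ∈ part (V₀ × W₀) (V₁ × W₁) α ↔
      (x.1.1, x.2.1) ∈ part V₀ V₁ α ∧ (x.1.2, x.2.2) ∈ part W₀ W₁ α := by
  obtain rfl | rfl := eq_zero_or_eq_one α
  · simp only [mem_part_zero, Prod.ext_iff, Prod.fst_zero, Prod.snd_zero]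
  · simp only [mem_part_one, Prod.ext_iff, Prod.fst_zero, Prod.snd_zero]

theorem IsLeibniz.directSum (hμ : IsLeibniz μ) (hν : IsLeibniz ν) :
    IsLeibniz (directSum μ ν) := by
  refine ⟨fun α β x y hx hy => ?_, fun α β x y z hy hz => ?_⟩
  · rw [mem_part_prod] at hx hy ⊢
    exact ⟨hμ.grading α β _ _ hx.1 hy.1, hν.grading α β _ _ hx.2 hy.2⟩
  · rw [mem_part_prod] at hy hz
    have hfst := Prod.ext_iff.1 (hμ.identity α β (x.1.1, x.2.1) _ _ hy.1 hz.1)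
    have hsnd := Prod.ext_iff.1 (hν.identity α β (x.1.2, x.2.2) _ _ hy.2 hz.2)
    exact Prod.ext (Prod.ext hfst.1 hsnd.1) (Prod.ext hfst.2 hsnd.2)

theorem IsNilpotent.directSum (hμ : IsNilpotent μ) (hν : IsNilpotent ν) :
    IsNilpotent (directSum μ ν) := by
  obtain ⟨⟨j, hj⟩, ⟨k, hk⟩⟩ := hμ, hν
  refine ⟨max j k, le_bot_iff.1 fun x hx => ?_⟩
  have hfst := map_mem_lowerCentral (ν := μ)
    (F := (LinearMap.fst ℂ V₀ W₀).prodMap (LinearMap.fst ℂ V₁ W₁)) (fun _ _ => rfl)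
    (lowerCentral_antitone (le_max_left j k) hx)
  have hsnd := map_mem_lowerCentral (ν := ν)
    (F := (LinearMap.snd ℂ V₀ W₀).prodMap (LinearMap.snd ℂ V₁ W₁)) (fun _ _ => rfl)
    (lowerCentral_antitone (le_max_right j k) hx)
  rw [hj, Submodule.mem_bot, Prod.ext_iff] at hfst
  rw [hk, Submodule.mem_bot, Prod.ext_iff] at hsnd
  exact Prod.ext (Prod.ext hfst.1 hsnd.1) (Prod.ext hfst.2 hsnd.2)

theorem lowerCentral_eq_bot_of_directSum {k : ℕ} (hk : lowerCentral (directSum μ ν) k = ⊥) :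
    lowerCentral μ k = ⊥ := by
  refine rightSeq_eq_bot_of_injective
    (F := (LinearMap.inl ℂ V₀ W₀).prodMap (LinearMap.inl ℂ V₁ W₁))
    (LinearMap.inl_injective.prodMap LinearMap.inl_injective) (fun x y => ?_) le_top le_top hk
  have h₀ : ν (0, 0) (0, 0) = 0 := map_zero _
  simp [directSum, h₀]

theorem isLeibniz_zero : IsLeibniz (0 : Law V₀ V₁) :=
  ⟨fun α β _ _ _ _ => zero_mem (part V₀ V₁ (α + β)), fun _ _ _ _ _ _ _ => by simp⟩

theorem isNilpotent_zero : IsNilpotent (0 : Law V₀ V₁) :=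
  ⟨1, le_bot_iff.1 (lowerCentral_succ_le_iff.2 fun _ _ _ => zero_mem _)⟩

end DirectSum

section Extremal

variable {V₀ V₁ : Type} [AddCommGroup V₀] [Module ℂ V₀] [AddCommGroup V₁] [Module ℂ V₁]

theorem partCentral_zero_one_eq_bot {μ : Law V₀ V₁}
    (h : ∀ x ∈ part V₀ V₁ 0, ∀ y ∈ part V₀ V₁ 0, μ x y = 0) : partCentral μ 0 1 = ⊥ :=
  le_bot_iff.1 <| Submodule.map₂_le.2 fun x hx y hy => (Submodule.mem_bot ℂ).2 (h x hx y hy)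

theorem notMem_ZF_of_partCentral_eq_bot {n m : ℕ} (hn : 2 ≤ n) {μ : StdLaw n m}
    (h : partCentral μ 0 1 = ⊥) : μ ∉ ZF n m :=
  fun hZF => (hn.trans (hZF.2.1.2 h)).not_gt one_lt_two

theorem mem_M_of_lowerCentral_ne_bot {n m k : ℕ} {μ : StdLaw n m} (hμ : μ ∈ N n m)
    (hne : lowerCentral μ k ≠ ⊥) (hbound : ∀ ν ∈ N n m, lowerCentral ν (k + 1) = ⊥) :
    μ ∈ M n m := by
  refine ⟨hμ, ⟨μ, hμ, rfl⟩, ?_⟩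
  rintro _ ⟨ν, hν, rfl⟩
  have hk : k < nilindex μ := not_le.1 (mt hμ.2.nilindex_le_iff.1 hne)
  exact (hν.2.nilindex_le_iff.2 (hbound ν hν)).trans hk

end Extremal

section Model

theorem shift_zero {n : ℕ} (u : Fin (n + 1) → ℂ) : shift (n + 1) u 0 = 0 := by
  simp [shift]

theorem shift_succ {n : ℕ} (u : Fin (n + 1) → ℂ) (i : Fin n) :
    shift (n + 1) u i.succ = u i.castSucc := by
  have hiff (j : Fin (n + 1)) : (j : ℕ) = i ↔ j = i.castSucc := by
    simp [Fin.ext_iff]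
  simp [shift, hiff]

theorem shift_single_castSucc {n : ℕ} (i : Fin n) :
    shift (n + 1) (Pi.single i.castSucc 1) = Pi.single i.succ 1 := by
  ext j
  cases j using Fin.cases with
  | zero => simp [shift_zero]
  | succ j => simp [shift_succ, Pi.single_apply]

theorem shift_pow_apply_eq_zero {m k : ℕ} (u : Fin m → ℂ) {i : Fin m} (hi : (i : ℕ) < k) :
    (shift m ^ k) u i = 0 := by
  obtain _ | n := m
  · exact i.elim0
  induction k generalizing i with
  | zero => exact absurd hi (Nat.not_lt_zero _)
  | succ k ih =>
    rw [pow_succ', Module.End.mul_apply]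
    cases i using Fin.cases with
    | zero => exact shift_zero _
    | succ i => exact (shift_succ _ i).trans (ih (Nat.lt_of_succ_lt_succ hi))

theorem shift_pow_self (m : ℕ) : shift m ^ m = 0 :=
  LinearMap.ext fun u => funext fun i => shift_pow_apply_eq_zero u i.isLt

/-- The signed pairing `(u, v) ↦ ∑ᵢ (-1)ⁱ uᵢ v_{m-1-i}`, by which two odd elements of `K^{2,m}`
multiply into the line spanned by `X₁`. -/
noncomputable def pairing (m : ℕ) : LinearMap.BilinForm ℂ (Fin m → ℂ) :=
  ∑ i : Fin m, (-1 : ℂ) ^ (i : ℕ) •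
    LinearMap.BilinForm.linMulLin (LinearMap.proj i) (LinearMap.proj i.rev)

theorem pairing_apply (m : ℕ) (u v : Fin m → ℂ) :
    pairing m u v = ∑ i : Fin m, (-1) ^ (i : ℕ) * u i * v i.rev := by
  simp [pairing, mul_assoc]

theorem pairing_single_left {m : ℕ} (i : Fin m) (v : Fin m → ℂ) :
    pairing m (Pi.single i 1) v = (-1) ^ (i : ℕ) * v i.rev := by
  simp [pairing_apply, Pi.single_apply]

theorem pairing_shift (m : ℕ) (u v : Fin m → ℂ) :
    pairing m (shift m u) v = -pairing m u (shift m v) := by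
  obtain _ | n := m
  · simp [pairing_apply]
  have hleft : pairing (n + 1) (shift (n + 1) u) v =
      ∑ i : Fin n, (-1) ^ ((i : ℕ) + 1) * u i.castSucc * v i.rev.castSucc := by
    simp [pairing_apply, Fin.sum_univ_succ, shift_zero, shift_succ, Fin.rev_succ]
  have hright : pairing (n + 1) u (shift (n + 1) v) =
      ∑ i : Fin n, (-1) ^ (i : ℕ) * u i.castSucc * v i.rev.castSucc := by
    simp [pairing_apply, Fin.sum_univ_castSucc, shift_zero, shift_succ, Fin.rev_castSucc]
  rw [hleft, hright, ← Finset.sum_neg_distrib]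
  exact Finset.sum_congr rfl fun i _ => by ring

theorem pairing_comm {m : ℕ} (hm : Odd m) (u v : Fin m → ℂ) :
    pairing m u v = pairing m v u := by
  rw [pairing_apply, pairing_apply, ← Equiv.sum_comp Fin.revPerm]
  refine Finset.sum_congr rfl fun i _ => ?_
  have hparity : (i.rev : ℕ) % 2 = i % 2 := by
    have := Nat.odd_iff.1 hm
    rw [Fin.val_rev]
    omega
  rw [Fin.revPerm_apply, Fin.rev_rev, neg_one_pow_eq_pow_mod_two, hparity,
    ← neg_one_pow_eq_pow_mod_two]
  ring

theorem pairing_shift_swap {m : ℕ} (hm : Odd m) (u v : Fin m → ℂ) :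
    pairing m u (shift m v) = -pairing m v (shift m u) := by
  rw [pairing_comm hm, pairing_shift]

theorem K_apply (m : ℕ) (x y : (Fin 2 → ℂ) × (Fin m → ℂ)) :
    K m x y =
      (Pi.single 1 (pairing m x.2 y.2), x.1 0 • shift m y.2 - y.1 0 • shift m x.2) := by
  rw [pairing_apply]
  rfl

theorem K_mul_of_even {m : ℕ} {x y : (Fin 2 → ℂ) × (Fin m → ℂ)} (hx : x ∈ part _ _ 0)
    (hy : y ∈ part _ _ 0) : K m x y = 0 := by
  simp [K_apply, mem_part_zero.1 hx, mem_part_zero.1 hy]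

theorem K_isLeibniz {m : ℕ} (hm : Odd m) : IsLeibniz (K m) := by
  constructor
  · intro α β x y hx hy
    obtain rfl | rfl := eq_zero_or_eq_one α <;> obtain rfl | rfl := eq_zero_or_eq_one β <;>
      simp_all [mem_part_zero, mem_part_one, K_apply, CharTwo.add_self_eq_zero]
  · rintro α β ⟨x₀, x₁⟩ ⟨y₀, y₁⟩ ⟨z₀, z₁⟩ hy hz
    have hswap := pairing_shift_swap hm y₁ z₁
    obtain rfl | rfl := eq_zero_or_eq_one α <;> obtain rfl | rfl := eq_zero_or_eq_one β <;>
      simp only [mem_part_zero, mem_part_one] at hy hz <;> subst hy hz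
    all_goals simp [K_apply, sgn, ZMod.val_one, pairing_shift, hswap, smul_smul, mul_comm,
      Pi.single_neg]

theorem K_isLie {m : ℕ} (hm : Odd m) : IsLie (K m) := by
  refine ⟨K_isLeibniz hm, fun α β x y hx hy => ?_⟩
  obtain rfl | rfl := eq_zero_or_eq_one α <;> obtain rfl | rfl := eq_zero_or_eq_one β <;>
    simp only [mem_part_zero, mem_part_one] at hx hy
  all_goals simp [K_apply, sgn, ZMod.val_one, hx, hy, pairing_comm hm x.2]

theorem lowerCentral_K_succ_le (m k : ℕ) : lowerCentral (K m) (k + 1) ≤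
    (LinearMap.ker (LinearMap.proj (0 : Fin 2))).prod (LinearMap.range (shift m ^ (k + 1))) := by
  induction k with
  | zero =>
    refine lowerCentral_succ_le_iff.2 fun x _ y => ⟨by simp [K_apply], ?_⟩
    exact ⟨x.1 0 • y.2 - y.1 0 • x.2, by simp [K_apply]⟩
  | succ k ih =>
    refine lowerCentral_succ_le_iff.2 fun x hx y => ⟨by simp [K_apply], ?_⟩
    obtain ⟨hx₀, u, hu⟩ := ih hx
    replace hx₀ : x.1 0 = 0 := hx₀
    refine ⟨-y.1 0 • u, ?_⟩
    rw [pow_succ', Module.End.mul_apply, map_smul, hu]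
    simp [K_apply, hx₀]

theorem K_isNilpotent (m : ℕ) : IsNilpotent (K m) := by
  refine ⟨m + 2, le_bot_iff.1 (lowerCentral_succ_le_iff.2 fun x hx y => ?_)⟩
  obtain ⟨hx₀, u, hu⟩ := lowerCentral_K_succ_le m m hx
  replace hx₀ : x.1 0 = 0 := hx₀
  have hx₂ : x.2 = 0 := by rw [← hu, pow_succ, shift_pow_self, zero_mul, LinearMap.zero_apply]
  simp [K_apply, hx₀, hx₂]

theorem single_mem_lowerCentral_K {n : ℕ} (i : Fin (n + 1)) :
    (0, Pi.single i 1) ∈ lowerCentral (K (n + 1)) i := by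
  induction i using Fin.induction with
  | zero => exact Submodule.mem_top
  | succ i ih =>
    have hmul : K (n + 1) (0, Pi.single i.castSucc 1) (Pi.single 0 (-1), 0) =
        (0, Pi.single i.succ 1) := by
      simp [K_apply, shift_single_castSucc]
    exact hmul ▸ mul_mem_lowerCentral_succ ih _

theorem lowerCentral_K_ne_bot {m : ℕ} (hm : m ≠ 0) : lowerCentral (K m) m ≠ ⊥ := by
  obtain ⟨n, rfl⟩ := Nat.exists_eq_succ_of_ne_zero hm
  intro hbot
  have hmul : K (n + 1) (0, Pi.single (Fin.last n) 1) (0, Pi.single 0 1) =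
      (Pi.single 1 ((-1) ^ n), 0) := by
    simp [K_apply, pairing_single_left]
  have hmem := mul_mem_lowerCentral_succ (single_mem_lowerCentral_K (Fin.last n))
    (0, Pi.single 0 1)
  rw [hmul, Fin.val_last, hbot, Submodule.mem_bot] at hmem
  simpa using congrFun (congrArg Prod.fst hmem) 1

end Model

section Examples

theorem K_mem_N {m : ℕ} (hm : Odd m) : K m ∈ N 2 m :=
  ⟨K_isLeibniz hm, K_isNilpotent m⟩

theorem K_mem_M {m : ℕ} (hm : 5 ≤ m) (hodd : Odd m) : K m ∈ M 2 m :=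
  mem_M_of_lowerCentral_ne_bot (K_mem_N hodd) (lowerCentral_K_ne_bot (by omega)) fun _ hν =>
    hν.1.lowerCentral_succ_eq_bot hν.2 hm (by simp) (by simp)

theorem K_notMem_ZF (m : ℕ) : K m ∉ ZF 2 m :=
  notMem_ZF_of_partCentral_eq_bot le_rfl <|
    partCentral_zero_one_eq_bot fun _ hx _ hy => K_mul_of_even hx hy

theorem directSum_K_oddLine_mul_of_even {m : ℕ}
    {x y : ((Fin 2 → ℂ) × (Fin 0 → ℂ)) × ((Fin m → ℂ) × (Fin 1 → ℂ))} (hx : x ∈ part _ _ 0)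
    (hy : y ∈ part _ _ 0) : directSum (K m) oddLine x y = 0 := by
  have hK := Prod.ext_iff.1 (K_mul_of_even (mem_part_prod.1 hx).1 (mem_part_prod.1 hy).1)
  exact Prod.ext (Prod.ext hK.1 rfl) (Prod.ext hK.2 rfl)

theorem mem_M_of_isomorphic_directSum_K {m : ℕ} (hm : 5 ≤ m + 1) (hodd : Odd m)
    {μ : StdLaw 2 (m + 1)} (h : Isomorphic μ (directSum (K m) oddLine)) : μ ∈ M 2 (m + 1) := by
  refine mem_M_of_lowerCentral_ne_bot (k := m)
    ⟨h.isLeibniz ((K_isLeibniz hodd).directSum isLeibniz_zero),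
      h.isNilpotent ((K_isNilpotent m).directSum isNilpotent_zero)⟩ (fun hbot => ?_)
    fun _ hν => hν.1.lowerCentral_eq_bot_of_even hν.2 hm hodd.add_one (by simp) (by simp)
  exact lowerCentral_K_ne_bot hodd.pos.ne'
    (lowerCentral_eq_bot_of_directSum (h.lowerCentral_eq_bot_iff.1 hbot))

theorem notMem_ZF_of_isomorphic_directSum_K {m n : ℕ} {μ : StdLaw 2 n}
    (h : Isomorphic μ (directSum (K m) oddLine)) : μ ∉ ZF 2 n :=
  notMem_ZF_of_partCentral_eq_bot le_rfl <| h.partCentral_eq_bot <|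
    partCentral_zero_one_eq_bot fun _ hx _ hy => directSum_K_oddLine_mul_of_even hx hy

end Examples

end LeibnizSuper

theorem theorem6p7 (m : ℕ) (hm : 5 ≤ m) :
    ¬ (LeibnizSuper.M 2 m ⊆ LeibnizSuper.ZF 2 m) ∧
    (Odd m → LeibnizSuper.IsLie (LeibnizSuper.K m) ∧
      LeibnizSuper.K m ∈ LeibnizSuper.M 2 m ∧ LeibnizSuper.K m ∉ LeibnizSuper.ZF 2 m) ∧
    (Even m → ∃ μ : LeibnizSuper.StdLaw 2 m,
      LeibnizSuper.Isomorphic μ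
        (LeibnizSuper.directSum (LeibnizSuper.K (m - 1)) LeibnizSuper.oddLine) ∧
      μ ∈ LeibnizSuper.M 2 m ∧ μ ∉ LeibnizSuper.ZF 2 m) := by
  have hodd (ho : Odd m) : LeibnizSuper.IsLie (LeibnizSuper.K m) ∧
      LeibnizSuper.K m ∈ LeibnizSuper.M 2 m ∧ LeibnizSuper.K m ∉ LeibnizSuper.ZF 2 m :=
    ⟨LeibnizSuper.K_isLie ho, LeibnizSuper.K_mem_M hm ho, LeibnizSuper.K_notMem_ZF m⟩
  have heven (he : Even m) : ∃ μ : LeibnizSuper.StdLaw 2 m,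
      LeibnizSuper.Isomorphic μ
        (LeibnizSuper.directSum (LeibnizSuper.K (m - 1)) LeibnizSuper.oddLine) ∧
      μ ∈ LeibnizSuper.M 2 m ∧ μ ∉ LeibnizSuper.ZF 2 m := by
    obtain ⟨n, rfl⟩ := Nat.exists_eq_add_of_le' (by omega : 1 ≤ m)
    obtain ⟨μ, hμ⟩ := LeibnizSuper.exists_isomorphic_stdLaw (n := 2) (m := n + 1)
      (LeibnizSuper.directSum (LeibnizSuper.K n) LeibnizSuper.oddLine) (by simp) (by simp)
    have hn : Odd n := Nat.not_even_iff_odd.1 (Nat.even_add_one.1 he)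
    exact ⟨μ, hμ, LeibnizSuper.mem_M_of_isomorphic_directSum_K hm hn hμ,
      LeibnizSuper.notMem_ZF_of_isomorphic_directSum_K hμ⟩
  refine ⟨fun hsub => ?_, hodd, heven⟩
  obtain he | ho := Nat.even_or_odd m
  · obtain ⟨μ, -, hM, hZF⟩ := heven he
    exact hZF (hsub hM)
  · exact LeibnizSuper.K_notMem_ZF m (hsub (LeibnizSuper.K_mem_M hm ho))
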